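/- Let $q$ be a prime power and let $k\ge 3$ and $s$ be integers. For integers $n>r\ge k-1$, an $(n,r)$-arc in $\mathrm{PG}(k-1,q)$ is a set $\mathcal K$ of $n$ points such that every hyperplane contains at most $r$ points of $\mathcal K$ and some hyperplane contains exactly $r$ points of $\mathcal K$. An $(n,r)$-arc $\mathcal K$ is complete if there is no point $P\notin\mathcal K$ such that $\mathcal K\cup\{P\}$ is an $(n+1,r)$-arc. For $s\ge 0$ let $m^s(k,q)$ denote the maximum of all $n$ for which a complete $(n,k+s-1)$-arc in $\mathrm{PG}(k-1,q)$ exists (with $m^s(k,q)=0$ if there is none). Suppose that $0<s<q-2$, $(s+2)\mid q$, $k\ge 3$ and $$m^s(k,q)\ \ge\ (s+1)(q+1)+k-3.$$ Then $$m^s(k,q)=(s+1)(q+1)+k-2.$$ -/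

import Mathlib

open scoped LinearAlgebra.Projectivization

/-- The projective space `PG(k-1, q)` over the finite field `F` with `q` elements: the set of
one-dimensional subspaces of `F ^ k`. -/
abbrev PG (F : Type*) [Field F] (k : ℕ) : Type _ := ℙ F (Fin k → F)

namespace PG

variable {F : Type*} [Field F] {k : ℕ}

/-- A hyperplane of `PG(k-1, q)`: a flat of codimension 1, given by the corresponding linear
subspace of `F ^ k`, which has dimension `k - 1`. -/
def IsHyperplane (H : Submodule F (Fin k → F)) : Prop :=
  Module.finrank F H + 1 = k

/-- The set of points of `PG(k-1, q)` lying on the flat given by a linear subspace of `F ^ k`. -/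
def points (H : Submodule F (Fin k → F)) : Set (PG F k) :=
  {P | P.submodule ≤ H}

/-- `K` is an `(n, r)`-arc in `PG(k-1, q)`, `r ≥ k - 1`: a set of `n > r` points such that every
hyperplane meets `K` in at most `r` points and some hyperplane meets `K` in exactly `r` points. -/
structure IsArc (K : Set (PG F k)) (n r : ℕ) : Prop where
  le_r : k ≤ r + 1
  finite : K.Finite
  card_eq : K.ncard = n
  r_lt : r < n
  card_inter_le : ∀ H : Submodule F (Fin k → F), IsHyperplane H → (K ∩ points H).ncard ≤ r
  exists_card_inter_eq :
    ∃ H : Submodule F (Fin k → F), IsHyperplane H ∧ (K ∩ points H).ncard = r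

/-- An `(n, r)`-arc is complete if no further point can be added to it to form an
`(n + 1, r)`-arc. -/
def IsCompleteArc (K : Set (PG F k)) (n r : ℕ) : Prop :=
  IsArc K n r ∧ ∀ P : PG F k, P ∉ K → ¬ IsArc (insert P K) (n + 1) r

variable (F)

/-- The set of all `n` for which there is a complete `(n, k + s - 1)`-arc in `PG(k-1, q)`. -/
def completeArcSizes (k s : ℕ) : Set ℕ :=
  {n | ∃ K : Set (PG F k), IsCompleteArc K n (k + s - 1)}

/-- `m^s(k, q)`: the maximum size of a complete `(n, k + s - 1)`-arc in `PG(k-1, q)`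
(with value `0` if there is none). -/
noncomputable def maxCompleteArc (k s : ℕ) : ℕ :=
  sSup (completeArcSizes F k s)

theorem bddAbove_completeArcSizes [Finite F] (k s : ℕ) : BddAbove (completeArcSizes F k s) := by
  haveI : Finite (PG F k) := Quotient.finite _
  refine ⟨Nat.card (PG F k), ?_⟩
  rintro n ⟨K, hK, -⟩
  rw [← hK.card_eq]
  exact Set.ncard_le_card K

/-- Over a finite field, `maxCompleteArc` is a genuine maximum as soon as there is a complete
arc. -/
theorem isGreatest_maxCompleteArc [Finite F] (k s : ℕ) (h : (completeArcSizes F k s).Nonempty) :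
    IsGreatest (completeArcSizes F k s) (maxCompleteArc F k s) :=
  ⟨Nat.sSup_mem h (bddAbove_completeArcSizes F k s),
    fun _ hn => le_csSup (bddAbove_completeArcSizes F k s) hn⟩

end PG

namespace PG

open Module

/-! ### Dimension counts and cardinalities in finite vector spaces. -/

section Subspaces

variable {F D : Type*} [Field F] [AddCommGroup D] [Module F D]

/-! Dualise the arc to a code: the words are the vectors `c` of `F ^ k`, the coordinates are the
functionals `P · c` for `P` in the arc, and the zeros of `c` are the points of the arc on the
hyperplane with normal vector `c`. Nonzero words then have at most `k + s - 1` zeros. Shortening at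
a coordinate (projecting the arc from a point) lowers the dimension, the length and this bound by
one each, so most claims reduce to dimension 2, where double counting of zeros decides. This gives
`n ≤ (s + 1)(q + 1) + k - 2` (`card_add_two_le`). It remains to show that an arc one point shorter
extends, hence is not complete.

In code terms a new point is a hyperplane of words none of which has the maximal number of zeros. In
dimension 3 (`exists_isExtension_three`) the words with `s + 1` zeros form `q + 1` projective
points; as `s + 2 ∣ q`, counting modulo `s + 2` shows that they meet every line, so they contain a
line, which is the extension. In higher dimension (`exists_isExtension_succ`) each shortening has an
extension `B i`. Extensions are unique (`isExtension_unique`), so the `B i` agree on double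
shortenings and pairwise meet in codimension one. Hence they span a common space, which is the
extension sought, or share a nonzero word vanishing at all coordinates, which is impossible. -/

theorem finrank_le_finrank_inf_ker_add_one [FiniteDimensional F D] (C : Submodule F D) (f : Dual F D) :
    finrank F C ≤ finrank F ↥(C ⊓ LinearMap.ker f) + 1 := by
  have h1 := Submodule.finrank_sup_add_finrank_inf_eq C (LinearMap.ker f)
  have h2 := Submodule.finrank_le (C ⊔ LinearMap.ker f)
  have h3 : finrank F D ≤ finrank F (LinearMap.ker f) + 1 := by
    have h4 := f.finrank_range_add_finrank_ker
    have h5 := Submodule.finrank_le (LinearMap.range f)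
    rw [finrank_self] at h5
    omega
  omega

theorem finrank_inf_ker_add_one [FiniteDimensional F D] {C : Submodule F D} {f : Dual F D} (h : ∃ c ∈ C, f c ≠ 0) :
    finrank F ↥(C ⊓ LinearMap.ker f) + 1 = finrank F C := by
  refine le_antisymm ?_ (finrank_le_finrank_inf_ker_add_one C f)
  obtain ⟨c, hc, hfc⟩ := h
  refine Submodule.finrank_lt_finrank_of_lt (lt_of_le_of_ne inf_le_left fun he => hfc ?_)
  rw [← he] at hc
  exact hc.2

theorem exists_le_finrank_eq (C : Submodule F D) {m : ℕ} (h : m ≤ finrank F C) :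
    ∃ B ≤ C, finrank F B = m := by
  obtain ⟨v, hv⟩ := exists_linearIndependent_of_le_finrank h
  refine ⟨Submodule.span F (Set.range fun i => (v i : D)), ?_, ?_⟩
  · rw [Submodule.span_le]
    rintro _ ⟨i, rfl⟩
    exact (v i).2
  · have : LinearIndependent F fun i => (v i : D) :=
      hv.map' C.subtype (Submodule.ker_subtype C)
    simpa using finrank_span_eq_card this

theorem exists_ne_zero_mem_of_finrank_pos {C : Submodule F D} (h : 0 < finrank F C) :
    ∃ c ∈ C, c ≠ 0 := by
  by_contra! hc
  rw [(Submodule.eq_bot_iff C).2 hc, finrank_bot] at h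
  exact h.false

open scoped Classical in
/-- The nonzero vectors of a subspace of a finite vector space. -/
noncomputable def nonzeros [Fintype D] (C : Submodule F D) : Finset D :=
  Finset.univ.filter fun c => c ∈ C ∧ c ≠ 0

theorem mem_nonzeros [Fintype D] {C : Submodule F D} {c : D} :
    c ∈ nonzeros C ↔ c ∈ C ∧ c ≠ 0 := by
  simp [nonzeros]

theorem card_nonzeros_add_one [Fintype D] (C : Submodule F D) :
    (nonzeros C).card + 1 = Nat.card F ^ finrank F C := by
  classical
  have h : nonzeros C = (Finset.univ.filter fun c => c ∈ C).erase 0 := by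
    ext c
    simp [nonzeros, and_comm]
  rw [h, Finset.card_erase_add_one (by simp), ← Module.natCard_eq_pow_finrank,
    Nat.card_eq_fintype_card, Fintype.card_subtype]

end Subspaces

/-! ### Counting zeros of codewords. -/

section Zeros

variable {F D ι : Type*} [Field F] [AddCommGroup D] [Module F D]

open scoped Classical in
/-- The number of coordinates in `I` at which the codeword `c` vanishes, the coordinates being
given by linear functionals `φ i`. -/
noncomputable def zeros (φ : ι → Dual F D) (I : Finset ι) (c : D) : ℕ :=
  (I.filter fun i => φ i c = 0).card

variable {φ : ι → Dual F D} {I : Finset ι}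

theorem zeros_smul {a : F} (ha : a ≠ 0) (c : D) : zeros φ I (a • c) = zeros φ I c := by
  classical
  rw [zeros, zeros]
  congr 1
  exact Finset.filter_congr fun i _ => by rw [map_smul, smul_eq_zero_iff_right ha]

theorem zeros_erase_add_one [DecidableEq ι] {i : ι} (hi : i ∈ I) {c : D} (hc : φ i c = 0) :
    zeros φ (I.erase i) c + 1 = zeros φ I c := by
  classical
  rw [zeros, zeros, Finset.filter_erase, Finset.card_erase_add_one (by simp [hi, hc])]

theorem zeros_eq_card {c : D} (h : ∀ i ∈ I, φ i c = 0) : zeros φ I c = I.card := by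
  classical
  rw [zeros, Finset.filter_true_of_mem h]

theorem exists_of_zeros_pos {c : D} (h : 0 < zeros φ I c) : ∃ i ∈ I, φ i c = 0 := by
  classical
  obtain ⟨i, hi⟩ := Finset.card_pos.1 h
  exact ⟨i, (Finset.mem_filter.1 hi).1, (Finset.mem_filter.1 hi).2⟩

theorem sum_zeros_eq_sum_card (A : Finset D) [DecidableEq F] :
    ∑ c ∈ A, zeros φ I c = ∑ i ∈ I, (A.filter fun c => φ i c = 0).card := by
  classical
  simp only [zeros, Finset.card_filter]
  rw [Finset.sum_comm]
  congr!

theorem sum_zeros_nonzeros [Fintype D] (B : Submodule F D) :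
    ∑ c ∈ nonzeros B, zeros φ I c = ∑ i ∈ I, (nonzeros (B ⊓ LinearMap.ker (φ i))).card := by
  classical
  rw [sum_zeros_eq_sum_card]
  refine Finset.sum_congr rfl fun i _ => ?_
  congr 1
  ext c
  simp only [Finset.mem_filter, mem_nonzeros, Submodule.mem_inf, LinearMap.mem_ker]
  tauto

end Zeros

end PG

namespace PG

open Module

/-! ### The length bound, and codes one short of it. -/

section NearExtremal

variable {F D ι : Type*} [Field F] [AddCommGroup D] [Module F D]

theorem card_le_card_nonzeros_inf_ker [Fintype D] {B : Submodule F D} (hB : finrank F B = 2)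
    (f : Dual F D) :
    Nat.card F ≤ (nonzeros (B ⊓ LinearMap.ker f)).card + 1 := by
  have := finrank_le_finrank_inf_ker_add_one B f
  rw [card_nonzeros_add_one]
  exact Nat.le_self_pow (by omega) _

/-- Here and below `u = q - 2`, so `u + 1 = q - 1` and `u + 3 = q + 1` without truncated
subtraction. -/
theorem card_nonzeros_of_finrank_eq_two [Fintype D] {B : Submodule F D} (hB : finrank F B = 2)
    {u : ℕ} (hu : Nat.card F = u + 2) : (nonzeros B).card = (u + 1) * (u + 3) := by
  have h := card_nonzeros_add_one B
  rw [hB, hu] at h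
  have : (u + 2) ^ 2 = (u + 1) * (u + 3) + 1 := by ring
  omega

variable {φ : ι → Dual F D} {I : Finset ι}

theorem card_mul_le_sum_zeros [Fintype D] {B : Submodule F D} (hB : finrank F B = 2)
    {u : ℕ} (hu : Nat.card F = u + 2) : I.card * (u + 1) ≤ ∑ c ∈ nonzeros B, zeros φ I c := by
  rw [sum_zeros_nonzeros, ← smul_eq_mul]
  refine Finset.card_nsmul_le_sum _ _ _ fun i _ => ?_
  have := card_le_card_nonzeros_inf_ker hB (φ i)
  omega

/-- In dimension 2 each coordinate vanishes on at least `q - 1` nonzero words, while the `q ^ 2 - 1`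
nonzero words have at most `s + 1` zeros each. Shortening reduces to this case. -/
theorem card_add_two_le [Finite F] [Finite D] {s : ℕ} {k : ℕ} (hk : 2 ≤ k) :
    ∀ {C : Submodule F D} {I : Finset ι}, finrank F C = k →
      (∀ c ∈ C, c ≠ 0 → zeros φ I c + 1 ≤ k + s) →
      I.card + 2 ≤ (s + 1) * (Nat.card F + 1) + k := by
  classical
  have := Fintype.ofFinite D
  obtain ⟨u, hu⟩ : ∃ u, Nat.card F = u + 2 :=
    Nat.exists_eq_add_of_le' Finite.one_lt_card
  induction k, hk using Nat.le_induction with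
  | base =>
    intro C I hC hz
    have h1 : I.card * (u + 1) ≤ ∑ c ∈ nonzeros C, zeros φ I c :=
      card_mul_le_sum_zeros hC hu
    have h2 : ∑ c ∈ nonzeros C, zeros φ I c ≤ (nonzeros C).card * (s + 1) := by
      rw [← smul_eq_mul]
      refine Finset.sum_le_card_nsmul _ _ _ fun c hc => ?_
      have := hz c (mem_nonzeros.1 hc).1 (mem_nonzeros.1 hc).2
      omega
    have h4 := card_nonzeros_of_finrank_eq_two hC hu
    have h5 : I.card * (u + 1) ≤ ((s + 1) * (u + 3)) * (u + 1) := by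
      rw [h4] at h2
      calc _ ≤ _ := h1.trans h2
        _ = _ := by ring
    have h6 := Nat.le_of_mul_le_mul_right h5 (Nat.succ_pos u)
    rw [hu, show u + 2 + 1 = u + 3 from rfl]
    omega
  | succ k hk ih =>
    intro C I hC hz
    obtain rfl | ⟨i, hi⟩ := I.eq_empty_or_nonempty
    · simp
      omega
    have h1 := finrank_le_finrank_inf_ker_add_one C (φ i)
    obtain ⟨B, hBC, hB⟩ := exists_le_finrank_eq (C ⊓ LinearMap.ker (φ i)) (m := k) (by omega)
    have h2 := ih (C := B) (I := I.erase i) hB fun c hc hc0 => by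
      have := hz c (hBC hc).1 hc0
      have := zeros_erase_add_one hi (hBC hc).2
      omega
    have := Finset.card_erase_add_one hi
    omega

/-- A code `C` of dimension `k` with coordinates `I`, in which nonzero words have at most
`k + s - 1` zeros, and whose length is one less than the bound of `card_add_two_le`. -/
structure IsNearExtremal (φ : ι → Dual F D) (s k : ℕ) (C : Submodule F D) (I : Finset ι) :
    Prop where
  finrank_eq : finrank F C = k
  card_eq : I.card + 3 = (s + 1) * (Nat.card F + 1) + k
  zeros_le : ∀ c ∈ C, c ≠ 0 → zeros φ I c + 1 ≤ k + s

namespace IsNearExtremal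

variable {s k : ℕ} {C : Submodule F D}

theorem shorten [DecidableEq ι] (h : IsNearExtremal φ s (k + 1) C I) {i : ι} (hi : i ∈ I)
    {B : Submodule F D} (hBC : B ≤ C ⊓ LinearMap.ker (φ i)) (hB : finrank F B = k) :
    IsNearExtremal φ s k B (I.erase i) where
  finrank_eq := hB
  card_eq := by
    have := h.card_eq
    have := Finset.card_erase_add_one hi
    omega
  zeros_le c hc hc0 := by
    have := h.zeros_le c (hBC hc).1 hc0
    have := zeros_erase_add_one hi (hBC hc).2
    omega

theorem exists_apply_ne_zero [Finite F] (h : IsNearExtremal φ s k C I) {c : D} (hc : c ∈ C)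
    (hc0 : c ≠ 0) : ∃ i ∈ I, φ i c ≠ 0 := by
  by_contra! hvan
  have h1 := h.zeros_le c hc hc0
  rw [zeros_eq_card hvan] at h1
  have h2 := h.card_eq
  have h3 : 1 < Nat.card F := Finite.one_lt_card
  have h4 : (s + 1) * 3 ≤ (s + 1) * (Nat.card F + 1) := Nat.mul_le_mul_left _ (by omega)
  omega

theorem one_lt_card [Finite F] (h : IsNearExtremal φ s k C I) (hk : 2 ≤ k) : 1 < I.card := by
  have := h.card_eq
  have h1 : 1 < Nat.card F := Finite.one_lt_card
  have h2 : 1 * 3 ≤ (s + 1) * (Nat.card F + 1) := Nat.mul_le_mul (by omega) (by omega)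
  omega

theorem exists_mem [Finite F] (h : IsNearExtremal φ s k C I) (hk : 2 ≤ k) : ∃ i, i ∈ I :=
  Finset.card_pos.1 (by have := h.one_lt_card hk; omega)

/-- A hyperplane of the code in which no nonzero word has the maximal number of zeros; this
corresponds to a further coordinate which extends the code. -/
structure IsExtension (φ : ι → Dual F D) (s k : ℕ) (C : Submodule F D) (I : Finset ι)
    (B : Submodule F D) : Prop where
  le : B ≤ C
  finrank_eq : finrank F B + 1 = k
  zeros_le : ∀ c ∈ B, c ≠ 0 → zeros φ I c + 2 ≤ k + s

theorem IsExtension.inf_ker [Finite D] [DecidableEq ι] {B : Submodule F D}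
    (hB : IsExtension φ s (k + 1) C I B) {i : ι} (hi : i ∈ I) (hBi : ∃ c ∈ B, φ i c ≠ 0) :
    IsExtension φ s k (C ⊓ LinearMap.ker (φ i)) (I.erase i) (B ⊓ LinearMap.ker (φ i)) := by
  refine ⟨inf_le_inf_right _ hB.le, ?_, fun c hc hc0 => ?_⟩
  · have := finrank_inf_ker_add_one hBi
    have := hB.finrank_eq
    omega
  · have := hB.zeros_le c hc.1 hc0
    have := zeros_erase_add_one hi hc.2
    omega

variable [Finite F] [Finite D]

/-- No coordinate vanishes identically. -/
theorem exists_ne_zero (h : IsNearExtremal φ s k C I) (hk : 2 ≤ k) {i : ι} (hi : i ∈ I) :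
    ∃ c ∈ C, φ i c ≠ 0 := by
  classical
  have := Fintype.ofFinite D
  obtain ⟨u, hu⟩ : ∃ u, Nat.card F = u + 2 :=
    Nat.exists_eq_add_of_le' Finite.one_lt_card
  induction k, hk using Nat.le_induction generalizing C I with
  | base =>
    by_contra! hc
    have hle : C ⊓ LinearMap.ker (φ i) = C := inf_eq_left.2 fun c hcC => hc c hcC
    have h4 := card_nonzeros_of_finrank_eq_two h.finrank_eq hu
    -- A coordinate vanishing on `C` counts all `q ^ 2 - 1` nonzero words instead of `q - 1`, which
    -- exceeds the slack.
    have h1 : (u + 1) * (u + 3) + (I.erase i).card * (u + 1) ≤ ∑ c ∈ nonzeros C, zeros φ I c := by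
      rw [sum_zeros_nonzeros, ← Finset.add_sum_erase _ _ hi, hle, h4]
      refine Nat.add_le_add_left ?_ _
      rw [← smul_eq_mul]
      refine Finset.card_nsmul_le_sum _ _ _ fun i _ => ?_
      have := card_le_card_nonzeros_inf_ker h.finrank_eq (φ i)
      omega
    have h2 : ∑ c ∈ nonzeros C, zeros φ I c ≤ (nonzeros C).card * (s + 1) := by
      rw [← smul_eq_mul]
      refine Finset.sum_le_card_nsmul _ _ _ fun c hc => ?_
      have := h.zeros_le c (mem_nonzeros.1 hc).1 (mem_nonzeros.1 hc).2
      omega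
    have h5 : (u + 3 + (I.erase i).card) * (u + 1) ≤ ((s + 1) * (u + 3)) * (u + 1) := by
      rw [h4] at h2
      calc _ = _ := by ring
        _ ≤ _ := h1.trans h2
        _ = _ := by ring
    have h6 := Nat.le_of_mul_le_mul_right h5 (Nat.succ_pos u)
    have h7 := h.card_eq
    rw [hu, show u + 2 + 1 = u + 3 from rfl] at h7
    have := Finset.card_erase_add_one hi
    omega
  | succ k hk ih =>
    obtain ⟨j, hj, hji⟩ := Finset.exists_mem_ne (h.one_lt_card (by omega)) i
    have h1 := finrank_le_finrank_inf_ker_add_one C (φ j)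
    rw [h.finrank_eq] at h1
    obtain ⟨B, hBC, hB⟩ := exists_le_finrank_eq (C ⊓ LinearMap.ker (φ j)) (m := k) (by omega)
    obtain ⟨c, hc, hc'⟩ := ih (h.shorten hj hBC hB) (Finset.mem_erase.2 ⟨hji.symm, hi⟩)
    exact ⟨c, (hBC hc).1, hc'⟩

theorem finrank_inf_ker (h : IsNearExtremal φ s (k + 1) C I) (hk : 1 ≤ k) {i : ι} (hi : i ∈ I) :
    finrank F ↥(C ⊓ LinearMap.ker (φ i)) = k := by
  have := finrank_inf_ker_add_one (h.exists_ne_zero (by omega) hi)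
  have := h.finrank_eq
  omega

theorem inf_ker [DecidableEq ι] (h : IsNearExtremal φ s (k + 1) C I) (hk : 1 ≤ k) {i : ι}
    (hi : i ∈ I) : IsNearExtremal φ s k (C ⊓ LinearMap.ker (φ i)) (I.erase i) :=
  h.shorten hi le_rfl (h.finrank_inf_ker hk hi)

/-- Some word attains the maximal number of zeros. -/
theorem exists_zeros_eq (h : IsNearExtremal φ s k C I) (hk : 2 ≤ k) :
    ∃ c ∈ C, c ≠ 0 ∧ zeros φ I c + 1 = k + s := by
  classical
  have := Fintype.ofFinite D
  obtain ⟨u, hu⟩ : ∃ u, Nat.card F = u + 2 :=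
    Nat.exists_eq_add_of_le' Finite.one_lt_card
  induction k, hk using Nat.le_induction generalizing C I with
  | base =>
    by_contra! hc
    have h4 := card_nonzeros_of_finrank_eq_two h.finrank_eq hu
    have h1 : I.card * (u + 1) ≤ ∑ c ∈ nonzeros C, zeros φ I c :=
      card_mul_le_sum_zeros h.finrank_eq hu
    have h2 : ∑ c ∈ nonzeros C, zeros φ I c ≤ (nonzeros C).card * s := by
      rw [← smul_eq_mul]
      refine Finset.sum_le_card_nsmul _ _ _ fun c hc' => ?_
      have := h.zeros_le c (mem_nonzeros.1 hc').1 (mem_nonzeros.1 hc').2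
      have := hc c (mem_nonzeros.1 hc').1 (mem_nonzeros.1 hc').2
      omega
    have h5 : I.card * (u + 1) ≤ (s * (u + 3)) * (u + 1) := by
      rw [h4] at h2
      calc _ ≤ _ := h1.trans h2
        _ = _ := by ring
    have h6 := Nat.le_of_mul_le_mul_right h5 (Nat.succ_pos u)
    have h7 := h.card_eq
    rw [hu, show u + 2 + 1 = u + 3 from rfl, add_mul] at h7
    omega
  | succ k hk ih =>
    obtain ⟨i, hi⟩ := h.exists_mem (by omega)
    obtain ⟨c, hc, hc0, hz⟩ := ih (h.inf_ker (by omega) hi)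
    refine ⟨c, hc.1, hc0, ?_⟩
    have := zeros_erase_add_one hi hc.2
    omega

/-- A coordinate that extends the code is not one of its coordinates. -/
theorem exists_ne_zero_of_isExtension (h : IsNearExtremal φ s k C I) (hk : 3 ≤ k)
    {B : Submodule F D} (hB : IsExtension φ s k C I B) {i : ι} (hi : i ∈ I) :
    ∃ c ∈ B, φ i c ≠ 0 := by
  classical
  by_contra! hc
  -- If `φ i` vanished on `B`, then `B` would be a shortening at `i`, hence near-extremal, and would
  -- contain a word with the maximal number of zeros.
  obtain ⟨k, rfl⟩ : ∃ l, k = l + 1 := ⟨k - 1, by omega⟩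
  obtain ⟨c, hcB, hc0, hz⟩ := (h.shorten hi (fun c hcB => ⟨hB.le hcB, hc c hcB⟩)
    (by have := hB.finrank_eq; omega : finrank F B = k)).exists_zeros_eq (by omega)
  have := hB.zeros_le c hcB hc0
  have := zeros_erase_add_one hi (hc c hcB)
  omega

/-- In dimension 2 the total deficit `∑ (s + 1 - zeros)` is at most `q - 1`, and each extension
already uses up `q - 1`. In higher dimension two distinct extensions share a nonzero word `c`. Where
`φ i c ≠ 0`, induction identifies their sections by `ker (φ i)`, which is too large for a section of
`B₁ ⊓ B₂`; so `c` vanishes everywhere. -/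
theorem isExtension_unique (h : IsNearExtremal φ s k C I) (hk : 2 ≤ k) {B₁ B₂ : Submodule F D}
    (h₁ : IsExtension φ s k C I B₁) (h₂ : IsExtension φ s k C I B₂) : B₁ = B₂ := by
  classical
  have := Fintype.ofFinite D
  obtain ⟨u, hu⟩ : ∃ u, Nat.card F = u + 2 :=
    Nat.exists_eq_add_of_le' Finite.one_lt_card
  induction k, hk using Nat.le_induction generalizing C I B₁ B₂ with
  | base =>
    by_contra hne
    have hr₁ : finrank F B₁ = 1 := by have := h₁.finrank_eq; omega
    have hr₂ : finrank F B₂ = 1 := by have := h₂.finrank_eq; omega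
    have hinf : finrank F ↥(B₁ ⊓ B₂) = 0 := by
      by_contra h0
      apply hne
      rw [← Submodule.eq_of_le_of_finrank_le (inf_le_left : B₁ ⊓ B₂ ≤ B₁) (by omega)]
      exact Submodule.eq_of_le_of_finrank_le inf_le_right (by omega)
    have hdisj : Disjoint (nonzeros B₁) (nonzeros B₂) := by
      rw [Finset.disjoint_left]
      intro c hc hc'
      rw [Submodule.finrank_eq_zero, Submodule.eq_bot_iff] at hinf
      exact (mem_nonzeros.1 hc).2 (hinf c ⟨(mem_nonzeros.1 hc).1, (mem_nonzeros.1 hc').1⟩)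
    have hc₁ := card_nonzeros_add_one B₁
    have hc₂ := card_nonzeros_add_one B₂
    rw [hr₁, hu, pow_one] at hc₁
    rw [hr₂, hu, pow_one] at hc₂
    have h4 := card_nonzeros_of_finrank_eq_two h.finrank_eq hu
    have h1 : I.card * (u + 1) ≤ ∑ c ∈ nonzeros C, zeros φ I c :=
      card_mul_le_sum_zeros h.finrank_eq hu
    have hsub : nonzeros B₁ ∪ nonzeros B₂ ⊆ nonzeros C := by
      intro c hc
      rw [Finset.mem_union, mem_nonzeros, mem_nonzeros] at hc
      rw [mem_nonzeros]
      rcases hc with hc | hc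
      · exact ⟨h₁.le hc.1, hc.2⟩
      · exact ⟨h₂.le hc.1, hc.2⟩
    have h2 : ∑ c ∈ nonzeros C, zeros φ I c + (nonzeros B₁ ∪ nonzeros B₂).card
        ≤ (nonzeros C).card * (s + 1) := by
      have hU : (nonzeros B₁ ∪ nonzeros B₂).card =
          ∑ c ∈ nonzeros C, if c ∈ nonzeros B₁ ∪ nonzeros B₂ then 1 else 0 := by
        rw [Finset.sum_ite_mem, Finset.inter_eq_right.2 hsub, Finset.card_eq_sum_ones]
      rw [hU, ← Finset.sum_add_distrib, ← smul_eq_mul]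
      refine Finset.sum_le_card_nsmul _ _ _ fun c hc => ?_
      have := h.zeros_le c (mem_nonzeros.1 hc).1 (mem_nonzeros.1 hc).2
      split_ifs with hc'
      · rw [Finset.mem_union, mem_nonzeros, mem_nonzeros] at hc'
        rcases hc' with hc' | hc'
        · have := h₁.zeros_le c hc'.1 hc'.2
          omega
        · have := h₂.zeros_le c hc'.1 hc'.2
          omega
      · omega
    rw [Finset.card_union_of_disjoint hdisj] at h2
    have h5 : (I.card + 2) * (u + 1) ≤ ((s + 1) * (u + 3)) * (u + 1) := by
      rw [h4, show (nonzeros B₁).card = u + 1 by omega,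
        show (nonzeros B₂).card = u + 1 by omega] at h2
      calc _ = I.card * (u + 1) + (u + 1 + (u + 1)) := by ring
        _ ≤ _ := Nat.add_le_add_right h1 _
        _ ≤ _ := h2
        _ = _ := by ring
    have h6 := Nat.le_of_mul_le_mul_right h5 (Nat.succ_pos u)
    have h7 := h.card_eq
    rw [hu, show u + 2 + 1 = u + 3 from rfl] at h7
    omega
  | succ k hk ih =>
    by_contra hne
    have hr₁ := h₁.finrank_eq
    have hr₂ := h₂.finrank_eq
    have hsum := Submodule.finrank_sup_add_finrank_inf_eq B₁ B₂
    have hlt : finrank F B₁ < finrank F ↥(B₁ ⊔ B₂) := by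
      refine Submodule.finrank_lt_finrank_of_lt (lt_of_le_of_ne le_sup_left fun he => hne ?_)
      have : B₂ ≤ B₁ := he ▸ le_sup_right
      exact (Submodule.eq_of_le_of_finrank_le this (by omega)).symm
    have hle := Submodule.finrank_mono (sup_le h₁.le h₂.le)
    rw [h.finrank_eq] at hle
    obtain ⟨c, hc, hc0⟩ := exists_ne_zero_mem_of_finrank_pos
      (by omega : 0 < finrank F ↥(B₁ ⊓ B₂))
    have hvan : ∀ i ∈ I, φ i c = 0 := by
      intro i hi
      by_contra hci
      have hi₁ := finrank_inf_ker_add_one ⟨c, hc.1, hci⟩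
      have hi₂ := finrank_inf_ker_add_one ⟨c, hc.2, hci⟩
      have hi₃ := finrank_inf_ker_add_one ⟨c, hc, hci⟩
      have heq := ih (h.inf_ker (by omega) hi) (h₁.inf_ker hi ⟨c, hc.1, hci⟩)
        (h₂.inf_ker hi ⟨c, hc.2, hci⟩)
      have hle : B₁ ⊓ LinearMap.ker (φ i) ≤ B₁ ⊓ B₂ ⊓ LinearMap.ker (φ i) := fun x hx =>
        ⟨⟨hx.1, (heq ▸ hx : x ∈ B₂ ⊓ LinearMap.ker (φ i)).1⟩, hx.2⟩
      have := Submodule.finrank_mono hle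
      omega
    obtain ⟨i, hi, hci⟩ := h.exists_apply_ne_zero (h₁.le hc.1) hc0
    exact hci (hvan i hi)

end IsNearExtremal

end NearExtremal

end PG

namespace PG

open Module

/-! ### Small blocking sets of a projective plane. -/

section Blocking

variable {F E : Type*} [Field F] [AddCommGroup E] [Module F E]

theorem finrank_span_pair_eq_two {x y : E} (hx : x ≠ 0) (hy : y ∉ Submodule.span F {x}) :
    finrank F ↥(Submodule.span F {x, y}) = 2 := by
  have hli : LinearIndependent F ![x, y] := by
    rw [LinearIndependent.pair_iff' hx]
    rintro a rfl
    exact hy (Submodule.mem_span_singleton.2 ⟨a, rfl⟩)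
  have h := finrank_span_eq_card hli
  rwa [Matrix.range_cons, Matrix.range_cons, Matrix.range_empty, Set.union_empty,
    Set.singleton_union, Fintype.card_fin] at h

/-- In a projective plane of order `q`, a set of at most `q + 1` points that meets every line
contains all points of some line. -/
theorem exists_finrank_eq_two_subset [Finite F] [Finite E] (hE : finrank F E = 3) (Δ : Finset E)
    (h0 : (0 : E) ∉ Δ) (hsmul : ∀ a : F, a ≠ 0 → ∀ x ∈ Δ, a • x ∈ Δ)
    (hcard : Δ.card + 1 ≤ Nat.card F ^ 2)
    (hmeet : ∀ B : Submodule F E, finrank F B = 2 → ∃ x ∈ B, x ∈ Δ) :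
    ∃ B : Submodule F E, finrank F B = 2 ∧ ∀ x ∈ B, x ≠ 0 → x ∈ Δ := by
  classical
  obtain ⟨B₀, -, hB₀⟩ := exists_le_finrank_eq (⊤ : Submodule F E) (m := 2)
    (by rw [finrank_top, hE]; omega)
  obtain ⟨a, -, ha⟩ := hmeet B₀ hB₀
  have ha0 : a ≠ 0 := fun h => h0 (h ▸ ha)
  obtain ⟨S, hS⟩ := Submodule.exists_isCompl (Submodule.span F {a})
  have hS2 := Submodule.finrank_add_eq_of_isCompl hS
  rw [finrank_span_singleton ha0, hE] at hS2
  obtain ⟨b, hbS, hb⟩ := hmeet S (by omega)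
  have hb0 : b ≠ 0 := fun h => h0 (h ▸ hb)
  have hba : b ∉ Submodule.span F {a} := fun h =>
    hb0 (Submodule.disjoint_def.1 hS.disjoint b h hbS)
  refine ⟨Submodule.span F {a, b}, finrank_span_pair_eq_two ha0 hba, fun c hc hc0 => ?_⟩
  by_contra hcΔ
  -- Project from `c`: every line through `c` meets `Δ`, so `Δ` covers the `q ^ 2 - 1` nonzero
  -- vectors of the quotient and, by its size, does so injectively. But suitable multiples of `a`
  -- and `b` have the same image.
  let π := (Submodule.span F {c}).mkQ
  have := Finite.of_surjective _ (Submodule.span F {c}).mkQ_surjective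
  have := Fintype.ofFinite (E ⧸ Submodule.span F {c})
  have hπc : π c = 0 := by simp [π]
  have hQ := (Submodule.span F {c}).finrank_quotient_add_finrank
  rw [finrank_span_singleton hc0, hE] at hQ
  have hsub : nonzeros (⊤ : Submodule F (E ⧸ Submodule.span F {c})) ⊆ Δ.image π := by
    intro y hy
    obtain ⟨x, rfl⟩ := Submodule.mkQ_surjective _ y
    have hx : x ∉ Submodule.span F {c} := fun hx => (mem_nonzeros.1 hy).2 (by simpa using hx)
    obtain ⟨d, hd, hdΔ⟩ := hmeet _ (finrank_span_pair_eq_two hc0 hx)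
    obtain ⟨α, β, rfl⟩ := Submodule.mem_span_pair.1 hd
    have hβ : β ≠ 0 := by
      rintro rfl
      rw [zero_smul, add_zero] at hdΔ
      have hα : α ≠ 0 := by
        rintro rfl
        exact h0 (by simpa using hdΔ)
      have := hsmul α⁻¹ (inv_ne_zero hα) _ hdΔ
      rw [inv_smul_smul₀ hα] at this
      exact hcΔ this
    refine Finset.mem_image.2 ⟨_, hsmul β⁻¹ (inv_ne_zero hβ) _ hdΔ, ?_⟩
    rw [map_smul, map_add, map_smul, map_smul, hπc, smul_zero, zero_add, inv_smul_smul₀ hβ]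
  have hcardQ := card_nonzeros_add_one (⊤ : Submodule F (E ⧸ Submodule.span F {c}))
  rw [finrank_top, show finrank F (E ⧸ Submodule.span F {c}) = 2 by omega] at hcardQ
  have hle := Finset.card_le_card hsub
  have hinj : Set.InjOn π Δ :=
    Finset.card_image_iff.1 (le_antisymm Finset.card_image_le (by omega))
  obtain ⟨α, β, rfl⟩ := Submodule.mem_span_pair.1 hc
  have hα : α ≠ 0 := by
    rintro rfl
    rw [zero_smul, zero_add] at hcΔ hc0
    exact hcΔ (hsmul β (fun h => hc0 (by rw [h, zero_smul])) b hb)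
  have hβ : β ≠ 0 := by
    rintro rfl
    rw [zero_smul, add_zero] at hcΔ hc0
    exact hcΔ (hsmul α hα a ha)
  have heq : α • a = (-β) • b := hinj (hsmul α hα a ha) (hsmul _ (neg_ne_zero.2 hβ) b hb) (by
    rw [← sub_eq_zero, ← map_sub, neg_smul, sub_neg_eq_add]
    exact hπc)
  exact hc0 (by rw [heq, neg_smul, neg_add_cancel])

end Blocking

/-! ### Existence of extensions. -/

section Extend

variable {F D ι : Type*} [Field F] [AddCommGroup D] [Module F D]
variable {φ : ι → Dual F D} {I : Finset ι}

theorem sum_zeros_eq_card_mul [Fintype D] {B : Submodule F D} (hB : finrank F B = 2)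
    {u : ℕ} (hu : Nat.card F = u + 2) (h : ∀ i ∈ I, ∃ c ∈ B, φ i c ≠ 0) :
    ∑ c ∈ nonzeros B, zeros φ I c = I.card * (u + 1) := by
  rw [sum_zeros_nonzeros, ← smul_eq_mul]
  refine Finset.sum_eq_card_nsmul fun i hi => ?_
  have h1 := finrank_inf_ker_add_one (h i hi)
  have h2 := card_nonzeros_add_one (B ⊓ LinearMap.ker (φ i))
  rw [show finrank F ↥(B ⊓ LinearMap.ker (φ i)) = 1 by omega, pow_one, hu] at h2
  omega

namespace IsNearExtremal

variable {s k : ℕ} {C : Submodule F D} [Finite F] [Finite D]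

theorem sum_sub_zeros_eq [Fintype D] (h : IsNearExtremal φ s 2 C I) {u : ℕ}
    (hu : Nat.card F = u + 2) : ∑ c ∈ nonzeros C, (s + 1 - zeros φ I c) = u + 1 := by
  have h1 := sum_zeros_eq_card_mul h.finrank_eq hu fun i hi => h.exists_ne_zero le_rfl hi
  have h2 : ∑ c ∈ nonzeros C, (s + 1 - zeros φ I c) + ∑ c ∈ nonzeros C, zeros φ I c =
      (nonzeros C).card * (s + 1) := by
    rw [← Finset.sum_add_distrib, ← smul_eq_mul]
    refine Finset.sum_eq_card_nsmul fun c hc => ?_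
    have := h.zeros_le c (mem_nonzeros.1 hc).1 (mem_nonzeros.1 hc).2
    omega
  rw [h1, card_nonzeros_of_finrank_eq_two h.finrank_eq hu] at h2
  have h3 := h.card_eq
  rw [hu, show u + 2 + 1 = u + 3 from rfl] at h3
  have h4 : (u + 1) * (u + 3) * (s + 1) = (I.card + 1) * (u + 1) := by
    rw [show I.card + 1 = (s + 1) * (u + 3) by omega]
    ring
  rw [h4, add_mul] at h2
  omega

/-- The deficit is the same for the `q - 1` nonzero multiples of `c`, and all deficits sum to `q -
1`. -/
theorem le_zeros_of_finrank_eq_two (h : IsNearExtremal φ s 2 C I) {c : D} (hc : c ∈ C)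
    (hc0 : c ≠ 0) : s ≤ zeros φ I c := by
  have := Fintype.ofFinite D
  obtain ⟨u, hu⟩ : ∃ u, Nat.card F = u + 2 :=
    Nat.exists_eq_add_of_le' Finite.one_lt_card
  have hsub : nonzeros (Submodule.span F {c}) ⊆ nonzeros C := by
    intro x hx
    rw [mem_nonzeros] at hx ⊢
    exact ⟨(Submodule.span_singleton_le_iff_mem c C).2 hc hx.1, hx.2⟩
  have h1 : ∑ x ∈ nonzeros (Submodule.span F {c}), (s + 1 - zeros φ I x) ≤ u + 1 :=
    (Finset.sum_le_sum_of_subset hsub).trans_eq (h.sum_sub_zeros_eq hu)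
  have h2 : ∑ x ∈ nonzeros (Submodule.span F {c}), (s + 1 - zeros φ I x) =
      (nonzeros (Submodule.span F {c})).card * (s + 1 - zeros φ I c) := by
    rw [← smul_eq_mul]
    refine Finset.sum_eq_card_nsmul fun x hx => ?_
    rw [mem_nonzeros] at hx
    obtain ⟨a, rfl⟩ := Submodule.mem_span_singleton.1 hx.1
    rw [zeros_smul fun ha => hx.2 (by rw [ha, zero_smul])]
  have h3 := card_nonzeros_add_one (Submodule.span F {c})
  rw [finrank_span_singleton hc0, pow_one, hu] at h3
  rw [h2, show (nonzeros (Submodule.span F {c})).card = u + 1 by omega] at h1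
  have := Nat.le_of_mul_le_mul_left (h1.trans_eq (mul_one _).symm) (Nat.succ_pos u)
  omega

theorem card_filter_zeros_eq [Fintype D] (h : IsNearExtremal φ s 2 C I) {u : ℕ}
    (hu : Nat.card F = u + 2) : ((nonzeros C).filter fun c => zeros φ I c = s).card = u + 1 := by
  rw [← h.sum_sub_zeros_eq hu, Finset.card_filter]
  refine Finset.sum_congr rfl fun c hc => ?_
  rw [mem_nonzeros] at hc
  have h1 := h.le_zeros_of_finrank_eq_two hc.1 hc.2
  have h2 := h.zeros_le c hc.1 hc.2
  split_ifs <;> omega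

theorem exists_isExtension_three (h : IsNearExtremal φ s 3 C I) (hdvd : s + 2 ∣ Nat.card F) :
    ∃ B, IsExtension φ s 3 C I B := by
  classical
  have := Fintype.ofFinite D
  obtain ⟨u, hu⟩ : ∃ u, Nat.card F = u + 2 :=
    Nat.exists_eq_add_of_le' Finite.one_lt_card
  have hn : I.card = (s + 1) * (u + 3) := by
    have := h.card_eq
    rw [hu, show u + 2 + 1 = u + 3 from rfl] at this
    omega
  have hzeros : ∀ c ∈ C, c ≠ 0 → zeros φ I c = 0 ∨ zeros φ I c = s + 1 ∨ zeros φ I c = s + 2 := by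
    intro c hc hc0
    rcases Nat.eq_zero_or_pos (zeros φ I c) with hz | hz
    · exact Or.inl hz
    · obtain ⟨i, hi, hic⟩ := exists_of_zeros_pos hz
      -- A zero at `i` puts `c` in the shortening at `i`, where it has at least `s` further zeros.
      have h1 := (h.inf_ker (by omega) hi).le_zeros_of_finrank_eq_two ⟨hc, hic⟩ hc0
      have h2 := zeros_erase_add_one hi hic
      have h3 := h.zeros_le c hc hc0
      omega
  set Δ := (nonzeros C).filter fun c => zeros φ I c = s + 1 with hΔ
  have hΔi : ∀ i ∈ I, (Δ.filter fun c => φ i c = 0) =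
      (nonzeros (C ⊓ LinearMap.ker (φ i))).filter fun c => zeros φ (I.erase i) c = s := by
    intro i hi
    ext c
    simp only [hΔ, Finset.mem_filter, mem_nonzeros, Submodule.mem_inf, LinearMap.mem_ker]
    constructor
    · rintro ⟨⟨⟨hc, hc0⟩, hz⟩, hic⟩
      have := zeros_erase_add_one hi hic
      exact ⟨⟨⟨hc, hic⟩, hc0⟩, by omega⟩
    · rintro ⟨⟨⟨hc, hic⟩, hc0⟩, hz⟩
      have := zeros_erase_add_one hi hic
      exact ⟨⟨⟨hc, hc0⟩, by omega⟩, hic⟩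
  have hΔcard : Δ.card = (u + 1) * (u + 3) := by
    -- Each coordinate vanishes on exactly `q - 1` words of `Δ`, namely those of deficit one in its
    -- shortening.
    have h1 : ∑ c ∈ Δ, zeros φ I c = Δ.card * (s + 1) := by
      rw [← smul_eq_mul]
      exact Finset.sum_eq_card_nsmul fun c hc => (Finset.mem_filter.1 hc).2
    have h2 : ∑ c ∈ Δ, zeros φ I c = I.card * (u + 1) := by
      rw [sum_zeros_eq_sum_card, ← smul_eq_mul]
      refine Finset.sum_eq_card_nsmul fun i hi => ?_
      rw [hΔi i hi, (h.inf_ker (by omega) hi).card_filter_zeros_eq hu]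
    refine Nat.eq_of_mul_eq_mul_right (show 0 < s + 1 by omega) ?_
    calc Δ.card * (s + 1) = I.card * (u + 1) := h1.symm.trans h2
      _ = _ := by rw [hn]; ring
  have hmeet : ∀ B ≤ C, finrank F B = 2 → ∃ c ∈ B, c ∈ Δ := by
    intro B hBC hB
    by_cases hv : ∀ i ∈ I, ∃ c ∈ B, φ i c ≠ 0
    · by_contra! hno
      have h1 := sum_zeros_eq_card_mul hB hu hv
      have h2 : s + 2 ∣ ∑ c ∈ nonzeros B, zeros φ I c := by
        refine Finset.dvd_sum fun c hc => ?_
        rw [mem_nonzeros] at hc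
        rcases hzeros c (hBC hc.1) hc.2 with hz | hz | hz
        · simp [hz]
        · exact absurd (Finset.mem_filter.2 ⟨mem_nonzeros.2 ⟨hBC hc.1, hc.2⟩, hz⟩) (hno c hc.1)
        · simp [hz]
      rw [h1, hn] at h2
      rw [hu] at hdvd
      -- Modulo `s + 2` the count `(s + 1)(q + 1)(q - 1)` is `1`, since `q` is `0`; a line missing
      -- `Δ` would make it `0`.
      have h3 : s + 2 ∣ (s + 2) * ((u + 1) * (u + 3)) + 1 := by
        rw [show (s + 2) * ((u + 1) * (u + 3)) + 1 =
          (s + 1) * (u + 3) * (u + 1) + (u + 2) * (u + 2) by ring]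
        exact dvd_add h2 (hdvd.mul_right _)
      have h4 := (Nat.dvd_add_right (Dvd.intro _ rfl)).1 h3
      have := Nat.le_of_dvd one_pos h4
      omega
    · push Not at hv
      obtain ⟨i, hi, hiB⟩ := hv
      have hBi : B = C ⊓ LinearMap.ker (φ i) :=
        Submodule.eq_of_le_of_finrank_eq (fun c hc => ⟨hBC hc, hiB c hc⟩)
          (by rw [h.finrank_inf_ker (by omega) hi, hB])
      have h1 := (h.inf_ker (by omega) hi).card_filter_zeros_eq hu
      rw [← hΔi i hi] at h1
      obtain ⟨c, hc⟩ := Finset.card_pos.1 (by omega : 0 < (Δ.filter fun c => φ i c = 0).card)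
      rw [Finset.mem_filter] at hc
      exact ⟨c, hBi ▸ ⟨(mem_nonzeros.1 (Finset.mem_filter.1 hc.1).1).1, hc.2⟩, hc.1⟩
  have hΔC : ∀ c ∈ Δ, c ∈ C := fun c hc => (mem_nonzeros.1 (Finset.mem_filter.1 hc).1).1
  have hmem : ∀ x : C, x ∈ Δ.subtype (· ∈ C) ↔ (x : D) ∈ Δ := fun x => Finset.mem_subtype
  obtain ⟨B, hB, hBΔ⟩ := exists_finrank_eq_two_subset h.finrank_eq (Δ.subtype (· ∈ C))
    (by simp [hΔ, nonzeros])
    (by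
      intro a ha x hx
      rw [hmem, hΔ, Finset.mem_filter, mem_nonzeros] at hx ⊢
      refine ⟨⟨(a • x).2, ?_⟩, ?_⟩
      · rw [Submodule.coe_smul]
        exact smul_ne_zero ha hx.1.2
      · rw [Submodule.coe_smul, zeros_smul ha, hx.2])
    (by
      rw [Finset.card_subtype, Finset.filter_true_of_mem hΔC, hΔcard, hu]
      exact le_of_eq (by ring))
    (by
      intro B hB
      obtain ⟨c, hc, hcΔ⟩ := hmeet (B.map C.subtype) (Submodule.map_subtype_le C B)
        (by rw [LinearEquiv.finrank_eq (Submodule.equivSubtypeMap C B).symm, hB])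
      obtain ⟨x, hx, rfl⟩ := Submodule.mem_map.1 hc
      exact ⟨x, hx, (hmem x).2 hcΔ⟩)
  refine ⟨B.map C.subtype, Submodule.map_subtype_le C B, ?_, fun c hc hc0 => ?_⟩
  · rw [LinearEquiv.finrank_eq (Submodule.equivSubtypeMap C B).symm, hB]
  · obtain ⟨x, hx, rfl⟩ := Submodule.mem_map.1 hc
    have := (hmem x).1 (hBΔ x hx fun hx0 => hc0 (by rw [hx0, map_zero]))
    have := (Finset.mem_filter.1 this).2
    rw [Submodule.coe_subtype]
    omega

end IsNearExtremal

/-- Subspaces of equal dimension, any two of which meet in a subspace of codimension one, lie in a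
common subspace of one dimension more or contain a common subspace of one dimension less. -/
theorem exists_forall_le_or_exists_forall_ge [FiniteDimensional F D] {l : ℕ}
    (B : ι → Submodule F D) (hB : ∀ i ∈ I, finrank F (B i) = l + 1)
    (hBB : ∀ i ∈ I, ∀ j ∈ I, i ≠ j → finrank F ↥(B i ⊓ B j) = l) (hI : 1 < I.card) :
    (∃ W : Submodule F D, finrank F W = l + 2 ∧
      (∀ V : Submodule F D, (∀ i ∈ I, B i ≤ V) → W ≤ V) ∧ ∀ i ∈ I, B i ≤ W) ∨
    ∃ U : Submodule F D, finrank F U = l ∧ ∀ i ∈ I, U ≤ B i := by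
  obtain ⟨i, hi, j, hj, hij⟩ := Finset.one_lt_card.1 hI
  have hW := Submodule.finrank_sup_add_finrank_inf_eq (B i) (B j)
  have hU := hBB i hi j hj hij
  rw [hB i hi, hB j hj, hU] at hW
  by_cases hall : ∀ m ∈ I, B m ≤ B i ⊔ B j
  · exact Or.inl ⟨B i ⊔ B j, by omega, fun V hV => sup_le (hV i hi) (hV j hj), hall⟩
  push Not at hall
  obtain ⟨m, hm, hmW⟩ := hall
  -- The spaces `B m ⊓ B i` and `B m ⊓ B j` have dimension `l` and lie in `B m ⊓ (B i ⊔ B j)`, of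
  -- dimension at most `l`; so all three coincide.
  have key : ∀ m ∈ I, ¬ B m ≤ B i ⊔ B j → B m ⊓ (B i ⊔ B j) = B i ⊓ B j := by
    intro m hm hmW
    have hmi : m ≠ i := fun h => hmW (h ▸ le_sup_left)
    have hmj : m ≠ j := fun h => hmW (h ▸ le_sup_right)
    have hlt : finrank F ↥(B m ⊓ (B i ⊔ B j)) < finrank F (B m) :=
      Submodule.finrank_lt_finrank_of_lt
        (lt_of_le_of_ne inf_le_left fun h => hmW (inf_eq_left.1 h))
    rw [hB m hm] at hlt
    have h1 : B m ⊓ B i = B m ⊓ (B i ⊔ B j) :=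
      Submodule.eq_of_le_of_finrank_le (inf_le_inf_left _ le_sup_left)
        (by rw [hBB m hm i hi hmi]; omega)
    have h2 : B m ⊓ B j = B m ⊓ (B i ⊔ B j) :=
      Submodule.eq_of_le_of_finrank_le (inf_le_inf_left _ le_sup_right)
        (by rw [hBB m hm j hj hmj]; omega)
    refine Submodule.eq_of_le_of_finrank_le
      (le_inf (h1 ▸ inf_le_right) (h2 ▸ inf_le_right)) ?_
    rw [hU, ← h1, hBB m hm i hi hmi]
  refine Or.inr ⟨B i ⊓ B j, hU, fun t ht => ?_⟩
  by_cases htW : B t ≤ B i ⊔ B j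
  · have htm : t ≠ m := fun h => hmW (h ▸ htW)
    have h1 : B t ⊓ B m ≤ B i ⊓ B j :=
      key m hm hmW ▸ le_inf inf_le_right (inf_le_left.trans htW)
    rw [← Submodule.eq_of_le_of_finrank_le h1 (by rw [hU, hBB t ht m hm htm])]
    exact inf_le_left
  · rw [← key t ht htW]
    exact inf_le_left

namespace IsNearExtremal

variable {s k : ℕ} {C : Submodule F D} [Finite F] [Finite D]

theorem exists_isExtension_succ (hk : 3 ≤ k)
    (ih : ∀ {C : Submodule F D} {I : Finset ι}, IsNearExtremal φ s k C I →
      ∃ B, IsExtension φ s k C I B)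
    (h : IsNearExtremal φ s (k + 1) C I) : ∃ B, IsExtension φ s (k + 1) C I B := by
  classical
  obtain ⟨l, rfl⟩ : ∃ l, k = l + 2 := ⟨k - 2, by omega⟩
  have hex : ∀ i ∈ I, ∃ B, IsExtension φ s (l + 2) (C ⊓ LinearMap.ker (φ i)) (I.erase i) B :=
    fun i hi => ih (h.inf_ker (by omega) hi)
  choose! B hB using hex
  have hne : ∀ i ∈ I, ∀ j ∈ I, i ≠ j → ∃ c ∈ B i, φ j c ≠ 0 := fun i hi j hj hij =>
    (h.inf_ker (by omega) hi).exists_ne_zero_of_isExtension hk (hB i hi)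
      (Finset.mem_erase.2 ⟨hij.symm, hj⟩)
  have hcomm : ∀ i ∈ I, ∀ j ∈ I, i ≠ j →
      B i ⊓ LinearMap.ker (φ j) = B j ⊓ LinearMap.ker (φ i) := by
    intro i hi j hj hij
    have hj' : j ∈ I.erase i := Finset.mem_erase.2 ⟨hij.symm, hj⟩
    have hi' : i ∈ I.erase j := Finset.mem_erase.2 ⟨hij, hi⟩
    have h1 := (hB i hi).inf_ker hj' (hne i hi j hj hij)
    have h2 := (hB j hj).inf_ker hi' (hne j hj i hi hij.symm)
    rw [inf_right_comm, Finset.erase_right_comm] at h2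
    exact ((h.inf_ker (by omega) hi).inf_ker (by omega) hj').isExtension_unique (by omega) h1 h2
  have hBrank : ∀ i ∈ I, finrank F (B i) = l + 1 := fun i hi => by
    have := (hB i hi).finrank_eq
    omega
  have hBB : ∀ i ∈ I, ∀ j ∈ I, i ≠ j → finrank F ↥(B i ⊓ B j) = l := by
    intro i hi j hj hij
    have h1 : B i ⊓ B j = B i ⊓ LinearMap.ker (φ j) := by
      refine le_antisymm (inf_le_inf_left _ fun c hc => ((hB j hj).le hc).2) ?_
      exact le_inf inf_le_left (hcomm i hi j hj hij ▸ inf_le_left)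
    have h2 := finrank_inf_ker_add_one (hne i hi j hj hij)
    rw [hBrank i hi] at h2
    rw [h1]
    omega
  have hI := h.one_lt_card (by omega)
  rcases exists_forall_le_or_exists_forall_ge B hBrank hBB hI with
    ⟨W, hW, hWle, hBW⟩ | ⟨U, hU, hUB⟩
  · refine ⟨W, hWle C fun i hi => (hB i hi).le.trans inf_le_left, by omega, fun c hc hc0 => ?_⟩
    rcases Nat.eq_zero_or_pos (zeros φ I c) with hz | hz
    · omega
    obtain ⟨i, hi, hic⟩ := exists_of_zeros_pos hz
    obtain ⟨j, hj, hji⟩ := Finset.exists_mem_ne hI i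
    obtain ⟨x, hx, hix⟩ := hne j hj i hi hji
    have h1 := finrank_inf_ker_add_one ⟨x, hBW j hj hx, hix⟩
    -- Since `W` contains `B j`, it is not inside `ker (φ i)`, so dimensions agree. A word of `W`
    -- vanishing at `i` thus inherits the bound from `B i`.
    have h2 : B i = W ⊓ LinearMap.ker (φ i) :=
      Submodule.eq_of_le_of_finrank_le (le_inf (hBW i hi) fun c hc => ((hB i hi).le hc).2)
        (by rw [hBrank i hi]; omega)
    have hcB : c ∈ B i := h2 ▸ ⟨hc, hic⟩
    have h3 := (hB i hi).zeros_le c hcB hc0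
    have h4 := zeros_erase_add_one hi hic
    omega
  · obtain ⟨c, hc, hc0⟩ := exists_ne_zero_mem_of_finrank_pos (by omega : 0 < finrank F U)
    obtain ⟨i₀, hi₀⟩ := h.exists_mem (by omega)
    obtain ⟨i, hi, hic⟩ := h.exists_apply_ne_zero ((hB i₀ hi₀).le (hUB i₀ hi₀ hc)).1 hc0
    exact absurd ((hB i hi).le (hUB i hi hc)).2 hic

theorem exists_isExtension (hk : 3 ≤ k) (hdvd : s + 2 ∣ Nat.card F)
    (h : IsNearExtremal φ s k C I) : ∃ B, IsExtension φ s k C I B := by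
  induction k, hk using Nat.le_induction generalizing C I with
  | base => exact h.exists_isExtension_three hdvd
  | succ k hk ih => exact exists_isExtension_succ hk ih h

end IsNearExtremal

end Extend

end PG

namespace PG

/-! ### From arcs to codes and back. -/

open Module

variable {F : Type*} [Field F] {k : ℕ}

/-- The linear functional `c ↦ P · c` given by a representative of a point. -/
noncomputable def coord (P : PG F k) : Dual F (Fin k → F) :=
  dotProductEquiv F (Fin k) P.rep

/-- The hyperplane with normal vector `c`. -/
noncomputable def normalHyperplane (c : Fin k → F) : Submodule F (Fin k → F) :=
  LinearMap.ker (dotProductEquiv F (Fin k) c)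

theorem mem_normalHyperplane {c x : Fin k → F} : x ∈ normalHyperplane c ↔ c ⬝ᵥ x = 0 := Iff.rfl

theorem mem_points_normalHyperplane {c : Fin k → F} {P : PG F k} :
    P ∈ points (normalHyperplane c) ↔ coord P c = 0 := by
  change P.submodule ≤ _ ↔ P.rep ⬝ᵥ c = 0
  rw [Projectivization.submodule_eq, Submodule.span_singleton_le_iff_mem, mem_normalHyperplane,
    dotProduct_comm]

theorem mk_mem_points {H : Submodule F (Fin k → F)} {x : Fin k → F} (hx : x ≠ 0) :
    Projectivization.mk F x hx ∈ points H ↔ x ∈ H := by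
  change Projectivization.submodule _ ≤ H ↔ _
  rw [Projectivization.submodule_mk, Submodule.span_singleton_le_iff_mem]

theorem isHyperplane_normalHyperplane {c : Fin k → F} (hc : c ≠ 0) :
    IsHyperplane (normalHyperplane c) := by
  have h := Dual.finrank_ker_add_one_of_ne_zero
    (f := dotProductEquiv F (Fin k) c) (by simpa using hc)
  rwa [finrank_fin_fun] at h

theorem IsHyperplane.exists_eq_normalHyperplane {H : Submodule F (Fin k → F)}
    (hH : IsHyperplane H) : ∃ c ≠ 0, H = normalHyperplane c := by
  have hH' : finrank F H + 1 = k := hH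
  have hlt : H < ⊤ := by
    refine lt_top_iff_ne_top.2 ?_
    rintro rfl
    rw [finrank_top, finrank_fin_fun] at hH'
    omega
  obtain ⟨f, hf, hle⟩ := H.exists_le_ker_of_lt_top hlt
  obtain ⟨c, rfl⟩ := (dotProductEquiv F (Fin k)).surjective f
  have hc : c ≠ 0 := by
    rintro rfl
    exact hf (map_zero _)
  have h : finrank F (normalHyperplane c) + 1 = k := isHyperplane_normalHyperplane hc
  exact ⟨c, hc, Submodule.eq_of_le_of_finrank_le hle (by
    change finrank F (normalHyperplane c) ≤ _
    omega)⟩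

theorem ncard_inter_points (I : Finset (PG F k)) (c : Fin k → F) :
    ((I : Set (PG F k)) ∩ points (normalHyperplane c)).ncard = zeros coord I c := by
  classical
  rw [zeros, ← Set.ncard_coe_finset]
  congr 1
  ext P
  simp [mem_points_normalHyperplane]

/-- An arc whose code is near-extremal with an extension is not complete. -/
theorem exists_isArc_insert [Finite F] {s n : ℕ} (hk : 3 ≤ k) (hdvd : s + 2 ∣ Nat.card F)
    {K : Set (PG F k)} (hK : IsArc K n (k + s - 1))
    (hn : n + 3 = (s + 1) * (Nat.card F + 1) + k) :
    ∃ X ∉ K, IsArc (insert X K) (n + 1) (k + s - 1) := by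
  classical
  obtain ⟨I, rfl⟩ := hK.finite.exists_finset_coe
  have hne : IsNearExtremal coord s k ⊤ I := by
    refine ⟨by rw [finrank_top, finrank_fin_fun], ?_, fun c _ hc0 => ?_⟩
    · rw [← Set.ncard_coe_finset, hK.card_eq, hn]
    · have := hK.card_inter_le _ (isHyperplane_normalHyperplane hc0)
      rw [ncard_inter_points] at this
      omega
  obtain ⟨B, hB⟩ := hne.exists_isExtension hk hdvd
  -- The new point is the normal vector `x` of the extension `B`: words in `B` are the hyperplanes
  -- through it.
  obtain ⟨x, hx, rfl⟩ := IsHyperplane.exists_eq_normalHyperplane hB.finrank_eq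
  have hX : ∀ c, Projectivization.mk F x hx ∈ points (normalHyperplane c) ↔
      c ∈ normalHyperplane x := fun c => by
    rw [mk_mem_points, mem_normalHyperplane, mem_normalHyperplane, dotProduct_comm]
  have hXI : Projectivization.mk F x hx ∉ (I : Set (PG F k)) := by
    intro hXI
    obtain ⟨c, hc, hc'⟩ := hne.exists_ne_zero_of_isExtension hk hB (Finset.mem_coe.1 hXI)
    exact hc' (mem_points_normalHyperplane.1 ((hX c).2 hc))
  refine ⟨_, hXI, hK.le_r, hK.finite.insert _, ?_, hK.r_lt.trans (Nat.lt_succ_self n), ?_, ?_⟩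
  · rw [Set.ncard_insert_of_notMem hXI hK.finite, hK.card_eq]
  · intro H hH
    obtain ⟨c, hc0, rfl⟩ := hH.exists_eq_normalHyperplane
    by_cases hc : c ∈ normalHyperplane x
    · rw [Set.insert_inter_of_mem ((hX c).2 hc)]
      refine (Set.ncard_insert_le _ _).trans ?_
      have := hB.zeros_le c hc hc0
      rw [ncard_inter_points]
      omega
    · rw [Set.insert_inter_of_notMem fun h => hc ((hX c).1 h)]
      exact hK.card_inter_le _ hH
  · obtain ⟨H, hH, hHr⟩ := hK.exists_card_inter_eq
    obtain ⟨c, hc0, rfl⟩ := hH.exists_eq_normalHyperplane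
    refine ⟨_, hH, ?_⟩
    -- A hyperplane with the maximal number of points avoids the new point, so its count is
    -- unchanged.
    rw [Set.insert_inter_of_notMem, hHr]
    intro h
    have := hB.zeros_le c ((hX c).1 h) hc0
    rw [ncard_inter_points] at hHr
    omega

theorem IsArc.add_two_le [Finite F] {s n : ℕ} (hk : 3 ≤ k) {K : Set (PG F k)}
    (hK : IsArc K n (k + s - 1)) : n + 2 ≤ (s + 1) * (Nat.card F + 1) + k := by
  obtain ⟨I, rfl⟩ := hK.finite.exists_finset_coe
  rw [← hK.card_eq, Set.ncard_coe_finset]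
  refine card_add_two_le (φ := coord) (C := ⊤) (by omega) (by rw [finrank_top, finrank_fin_fun])
    fun c _ hc0 => ?_
  have := hK.card_inter_le _ (isHyperplane_normalHyperplane hc0)
  rw [ncard_inter_points] at this
  omega

end PG

theorem mainTheorem3 {F : Type*} [Field F] [Finite F] (q k s : ℕ) (hq : Nat.card F = q)
    (hs0 : 0 < s) (hsq : s + 2 < q) (hdvd : s + 2 ∣ q) (hk : 3 ≤ k)
    (hm : (s + 1) * (q + 1) + k - 3 ≤ PG.maxCompleteArc F k s) :
    PG.maxCompleteArc F k s = (s + 1) * (q + 1) + k - 2 := by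
  subst hq
  have hpos : 0 < (s + 1) * (Nat.card F + 1) := by positivity
  have hnonempty : (PG.completeArcSizes F k s).Nonempty := by
    rw [Set.nonempty_iff_ne_empty]
    intro h
    -- The default value `0` is ruled out, the lower bound being positive for `k ≥ 3`.
    rw [PG.maxCompleteArc, h, csSup_empty, Nat.bot_eq_zero] at hm
    omega
  obtain ⟨K, hK, hcomplete⟩ := (PG.isGreatest_maxCompleteArc F k s hnonempty).1
  have hle := hK.add_two_le hk
  by_contra hne
  -- Between the two bounds, the only size other than the claimed one is the near-extremal length.
  obtain ⟨X, hX, hXK⟩ := PG.exists_isArc_insert hk hdvd hK (by omega)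
  exact hcomplete X hX hXK
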